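/- Let $K$ be a field of characteristic $p>2$, let $a,b\ge 2$ be integers, and let $A=K[x,y]/(x^a,y^b)$ with its standard grading $A=\bigoplus_{i\ge 0}A_i$. We say that $A$ has the strong Lefschetz property (SLP) if there is a linear form $\lambda\in A_1$ such that for all $i\ge 0$ and all $m\ge 1$ the multiplication map $\cdot\lambda^m\colon A_i\to A_{i+m}$ is injective or surjective. Write $a$ and $b$ in base $p$ as $a=a_kp^k+\dots+a_1p+a_0$ and $b=b_\ell p^\ell+\dots+b_1p+b_0$, where $0\le a_i,b_i<p$ and $a_k,b_\ell\ne 0$, and assume, without loss of generality, that $\ell\ge k$. Then the following hold. 1. If $a,b<p$, then $A$ has the SLP if and only if $a+b\le p+1$. 2. If $a<p$ and $b\ge p$, then $A$ has the SLP if and only if $a\le\min(b_0,p-b_0)+1$. 3. If $a,b\ge p$, then $A$ has the SLP if and only if the following three conditions are all satisfied: (a) $a_0\in\{\frac{p-1}{2},\frac{p+1}{2}\}$ and $b_0\in\{\frac{p-1}{2},\frac{p+1}{2}\}$ (the two choices being independent); (b) $a_i=b_i=\frac{p-1}{2}$ for $i=1,2,\dots,k-1$; (c) $a_k+b_k\le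 p-1$, and, if $\ell>k$, also $b_k\ge a_k$. -/

import Mathlib

section GradedAlgebras

variable {K A : Type*} [Field K] [CommRing A] [Algebra K A]

/-- For a graded algebra `A = ⨁ i, A_i` and a homogeneous element `f ∈ A_d`, the `K`-linear
multiplication map `A_i → A_{i+d}`, `a ↦ f * a`. -/
def gradedMul (𝒜 : ℕ → Submodule K A) [GradedAlgebra 𝒜] {d : ℕ} (f : 𝒜 d) (i : ℕ) :
    𝒜 i →ₗ[K] 𝒜 (i + d) :=
  (LinearMap.mulLeft K (f : A)).restrict fun a ha => by
    rw [LinearMap.mulLeft_apply, mul_comm]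
    exact SetLike.mul_mem_graded ha f.2

/-- A linear map has maximal rank if it is injective or surjective. -/
def HasMaximalRank {V W : Type*} [AddCommGroup V] [Module K V] [AddCommGroup W] [Module K W]
    (φ : V →ₗ[K] W) : Prop :=
  Function.Injective φ ∨ Function.Surjective φ

/-- The power `ℓ ^ m` of a linear form `ℓ ∈ A_1`, as an element of `A_m`. -/
def linearFormPow (𝒜 : ℕ → Submodule K A) [GradedAlgebra 𝒜] (l : 𝒜 1) (m : ℕ) : 𝒜 m :=
  ⟨(l : A) ^ m, by simpa using SetLike.pow_mem_graded m l.2⟩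

/-- `ℓ ∈ A_1` is a strong Lefschetz element if, for all `i ≥ 0` and `m ≥ 1`, multiplication by
`ℓ ^ m` from `A_i` to `A_{i+m}` has maximal rank. -/
def IsStrongLefschetzElement (𝒜 : ℕ → Submodule K A) [GradedAlgebra 𝒜] (l : 𝒜 1) : Prop :=
  ∀ i m : ℕ, 1 ≤ m → HasMaximalRank (gradedMul 𝒜 (linearFormPow 𝒜 l m) i)

/-- The strong Lefschetz property of a graded algebra. -/
def HasStrongLefschetzProperty (𝒜 : ℕ → Submodule K A) [GradedAlgebra 𝒜] : Prop :=
  ∃ l : 𝒜 1, IsStrongLefschetzElement 𝒜 l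

/-- The grading of the quotient `A ⧸ I`: its degree `i` part is the image of `A_i`. -/
def quotientGrading (𝒜 : ℕ → Submodule K A) (I : Ideal A) (i : ℕ) : Submodule K (A ⧸ I) :=
  (𝒜 i).map (Ideal.Quotient.mkₐ K I).toLinearMap

theorem mk_mem_quotientGrading {𝒜 : ℕ → Submodule K A} (I : Ideal A) {i : ℕ} {a : A}
    (ha : a ∈ 𝒜 i) : Ideal.Quotient.mk I a ∈ quotientGrading 𝒜 I i :=
  ⟨a, ha, rfl⟩

/-- The quotient map `A_i → (A ⧸ I)_i`. -/
def quotientGradingMk (𝒜 : ℕ → Submodule K A) (I : Ideal A) (i : ℕ) :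
    𝒜 i →+ quotientGrading 𝒜 I i where
  toFun a := ⟨Ideal.Quotient.mk I a, mk_mem_quotientGrading I a.2⟩
  map_zero' := by ext; simp
  map_add' a b := by ext; simp

/-- The map sending the class of `a` to the family of classes of its homogeneous components. -/
noncomputable def quotientDecompose (𝒜 : ℕ → Submodule K A) [GradedAlgebra 𝒜] (I : Ideal A)
    (hI : I.IsHomogeneous 𝒜) : (A ⧸ I) →+ DirectSum ℕ fun i => quotientGrading 𝒜 I i :=
  QuotientAddGroup.lift I.toAddSubgroup
    ((DirectSum.map fun i => quotientGradingMk 𝒜 I i).comp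
      (DirectSum.decomposeAddEquiv 𝒜).toAddMonoidHom) (by
    intro a ha
    ext i
    have h := hI i (show a ∈ I from ha)
    simpa [quotientGradingMk, Ideal.Quotient.eq_zero_iff_mem] using h)

theorem quotientDecompose_mk (𝒜 : ℕ → Submodule K A) [GradedAlgebra 𝒜] (I : Ideal A)
    (hI : I.IsHomogeneous 𝒜) (a : A) : quotientDecompose 𝒜 I hI (Ideal.Quotient.mk I a) =
      DirectSum.map (fun i => quotientGradingMk 𝒜 I i) (DirectSum.decompose 𝒜 a) :=
  rfl

/-- The quotient of a graded algebra by a homogeneous ideal is a graded algebra. -/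
@[reducible] noncomputable def quotientGradedAlgebra (𝒜 : ℕ → Submodule K A) [GradedAlgebra 𝒜]
    (I : Ideal A) (hI : I.IsHomogeneous 𝒜) : GradedAlgebra (quotientGrading 𝒜 I) where
  one_mem := mk_mem_quotientGrading I SetLike.GradedOne.one_mem
  mul_mem := by
    rintro i j _ _ ⟨a, ha, rfl⟩ ⟨b, hb, rfl⟩
    exact mk_mem_quotientGrading I (SetLike.mul_mem_graded ha hb)
  toDecomposition := DirectSum.Decomposition.ofAddHom _ (quotientDecompose 𝒜 I hI)
    (by
      ext x
      obtain ⟨a, rfl⟩ := Ideal.Quotient.mk_surjective x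
      induction a using DirectSum.Decomposition.inductionOn 𝒜 with
      | zero => simp
      | homogeneous a => simp [quotientDecompose_mk, quotientGradingMk]
      | add a b ha hb => rw [map_add, map_add, ha, hb, map_add])
    (by
      ext i x : 2
      obtain ⟨_, a, ha, rfl⟩ := x
      lift a to 𝒜 i using ha
      simp only [AddMonoidHom.comp_apply, DirectSum.coeAddMonoidHom_of, AddMonoidHom.id_apply]
      change quotientDecompose 𝒜 I hI (Ideal.Quotient.mk I (a : A)) = _
      rw [quotientDecompose_mk, DirectSum.decompose_coe, DirectSum.map_of]
      rfl)

end GradedAlgebras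

section MonomialCompleteIntersection

attribute [local instance] MvPolynomial.gradedAlgebra

/-- The ideal `(x ^ a, y ^ b)` of `K[x, y]`, with `x = X 0` and `y = X 1`. -/
noncomputable def ciIdeal (K : Type*) [Field K] (a b : ℕ) : Ideal (MvPolynomial (Fin 2) K) :=
  Ideal.span {MvPolynomial.X 0 ^ a, MvPolynomial.X 1 ^ b}

/-- The algebra `K[x, y] / (x ^ a, y ^ b)`. -/
noncomputable abbrev CIAlgebra (K : Type*) [Field K] (a b : ℕ) : Type _ :=
  MvPolynomial (Fin 2) K ⧸ ciIdeal K a b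

/-- The standard grading of `K[x, y] / (x ^ a, y ^ b)`: the degree `i` part consists of the
classes of the homogeneous polynomials of degree `i`. -/
noncomputable def ciGrading (K : Type*) [Field K] (a b : ℕ) : ℕ → Submodule K (CIAlgebra K a b) :=
  quotientGrading (MvPolynomial.homogeneousSubmodule (Fin 2) K) (ciIdeal K a b)

theorem ciIdeal_isHomogeneous (K : Type*) [Field K] (a b : ℕ) :
    (ciIdeal K a b).IsHomogeneous (MvPolynomial.homogeneousSubmodule (Fin 2) K) := by
  apply Ideal.homogeneous_span
  rintro x (rfl | rfl)
  · exact ⟨a, MvPolynomial.isHomogeneous_X_pow 0 a⟩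
  · exact ⟨b, MvPolynomial.isHomogeneous_X_pow 1 b⟩

noncomputable instance ciGradedAlgebra (K : Type*) [Field K] (a b : ℕ) :
    GradedAlgebra (ciGrading K a b) :=
  quotientGradedAlgebra _ _ (ciIdeal_isHomogeneous K a b)

end MonomialCompleteIntersection

/-- `c k, …, c 1, c 0` are the base `p` digits of `n`, with nonzero leading digit `c k`. -/
structure IsBaseExpansion (p n k : ℕ) (c : ℕ → ℕ) : Prop where
  digit_lt : ∀ i ≤ k, c i < p
  leading_ne_zero : c k ≠ 0
  eq_sum : n = ∑ i ∈ Finset.range (k + 1), c i * p ^ i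

/-!
Multiplication by a power of the linear form `s x + t y` between complementary degrees `n - 1` and
`a + b - n - 1` of `A = K[x, y] / (x ^ a, y ^ b)` has, in the monomial bases, a square matrix of
binomial coefficients, scaled by powers of `s` and `t`. Such a map has maximal rank if and only if
its determinant is nonzero, and these maps for `1 ≤ n ≤ min a b` decide about all the others
(`isStrongLefschetzElement_iff`). A linear form with `s = 0` or `t = 0` fails already for `n = 1`;
otherwise the scaling is harmless, so that the strong Lefschetz property says that the determinants
of the integral matrices `binomialMatrix (a - n) (b - n) n` do not vanish in `K`
(`hasStrongLefschetzProperty_iff`).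

With `r = a - n` and `c = b - n` this determinant is the number of plane partitions in an
`r × c × n` box, by MacMahon's formula
`det = ∏ i < n, (r + c + i)! i! / ((r + i)! (c + i)!)` (`det_binomialMatrix_mul`), which follows
from column operations and a Vandermonde determinant. By Legendre's formula its `p`-adic valuation
is a sum over the powers `q` of `p` of nonnegative integers `boxDefect q r c n`, which depend only
on the residues of `r`, `c`, `n` modulo `q`. Such a term vanishes exactly when one of the residues
is zero or their sum is at most `q` or at least `2 q` (`boxDefect_nonneg_and_eq_zero_iff`). Hence
the strong Lefschetz property becomes a condition on residues for each power of `p`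
(`hasStrongLefschetzProperty_iff_allBoxesGood`).

It remains to read this condition in base `p`. For `q ≤ a, b` the number `n` takes all values modulo
`q`, which forces `a` and `b` to be `(q - 1) / 2` or `(q + 1) / 2` modulo `q`
(`allBoxesGood_iff_of_le`); for all these `q` together, this fixes the digits of `a` and `b` below
the position of the leading digit of `a`, up to the choice left for the last digits. For `a < q` and
`a ≤ b` the condition is `a ≤ b % q + 1` and `a + b % q ≤ q + 1` (`allBoxesGood_iff_of_lt`). It
propagates from one power of `p` to the next, so only the smallest power above `a` counts; it
compares the leading digit of `a` with the digit of `b` in the same position.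
-/

/-! ### The determinant of a matrix of binomial coefficients -/

/-- The `n × n` matrix of the coefficients `C(r + c, r + i - j)`, with the convention that the
entries with `r + i < j` vanish. -/
def binomialMatrix (r c n : ℕ) : Matrix (Fin n) (Fin n) ℤ :=
  Matrix.of fun i j => if (j : ℕ) ≤ r + i then ((r + c).choose (r + i - j) : ℤ) else 0

/-- The falling factorials are monic polynomials of degrees `0, 1, …, n - 1`, so the determinant is
that of Vandermonde, which does not depend on the shift `c`; for `c = 0` the matrix is
triangular. -/
theorem det_descFactorial_add (c n : ℕ) :
    (Matrix.of fun i j : Fin n => ((c + i).descFactorial j : ℤ)).det =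
      ∏ i ∈ Finset.range n, (i.factorial : ℤ) := by
  have key (c : ℕ) : (Matrix.of fun i j : Fin n => ((c + i).descFactorial j : ℤ)).det =
      (Matrix.vandermonde fun i : Fin n => (i : ℤ)).det := by
    rw [← Matrix.det_vandermonde_add (fun i : Fin n => (i : ℤ)) c,
      Matrix.det_eval_matrixOfPolynomials_eq_det_vandermonde _
        (fun j : Fin n => descPochhammer ℤ j) (fun j => descPochhammer_natDegree ℤ j)
        (fun j => monic_descPochhammer ℤ j)]
    congr 1
    ext i j
    simp only [Matrix.of_apply]
    rw [← descPochhammer_eval_eq_descFactorial]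
    push_cast
    rw [add_comm]
  rw [key c, ← key 0, Matrix.det_of_isLowerTriangular]
  · rw [← Fin.prod_univ_eq_prod_range (fun i => (i.factorial : ℤ))]
    simp [Nat.descFactorial_self]
  · intro i j hij
    have : (i : ℕ) < j := hij
    simp [Nat.descFactorial_eq_zero_iff_lt, this]

theorem det_choose_unitriangular (n : ℕ) :
    (Matrix.of fun i j : Fin n => ((j : ℕ).choose i : ℤ)).det = 1 := by
  rw [Matrix.det_of_isUpperTriangular]
  · simp
  · intro i j hij
    have : (j : ℕ) < i := hij
    simp [Nat.choose_eq_zero_of_lt this]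

theorem choose_factorial_identity (r c i j : ℕ) :
    (r + c + j).choose (r + i) * ((r + i).factorial * (c + j).factorial) =
      (r + c + j).factorial * (c + j).descFactorial i := by
  rcases le_or_gt i (c + j) with h | h
  · have h1 := Nat.choose_mul_factorial_mul_factorial (n := r + c + j) (k := r + i) (by omega)
    have h2 := Nat.factorial_mul_descFactorial h
    rw [show r + c + j - (r + i) = c + j - i by omega] at h1
    rw [← h1, ← h2]
    ring
  · rw [Nat.choose_eq_zero_of_lt (by omega), Nat.descFactorial_eq_zero_iff_lt.2 h]
    simp

/-- Vandermonde's convolution: column operations turn the entries `C(r + c, r + i - j)` into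
`C(r + c + j, r + i)`. -/
theorem binomialMatrix_mul_unitriangular (r c n : ℕ) :
    binomialMatrix r c n * (Matrix.of fun i j : Fin n => ((j : ℕ).choose i : ℤ)) =
      Matrix.of fun i j : Fin n => ((r + c + j).choose (r + i) : ℤ) := by
  ext i j
  simp only [Matrix.mul_apply, binomialMatrix, Matrix.of_apply]
  rw [Nat.add_comm (r + c) j, Nat.add_choose_eq, Finset.Nat.sum_antidiagonal_eq_sum_range_succ_mk,
    Fin.sum_univ_eq_sum_range (fun t => (if t ≤ r + i then
      ((r + c).choose (r + i - t) : ℤ) else 0) * ((j : ℕ).choose t : ℤ)) n]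
  push_cast
  -- both sums extend to `t < n + (r + i + 1)` by zero terms
  have e1 := Finset.sum_subset
    (f := fun t => (if t ≤ r + i then ((r + c).choose (r + i - t) : ℤ) else 0) *
      ((j : ℕ).choose t : ℤ))
    (Finset.range_subset_range.2 (show n ≤ n + (r + i + 1) by omega)) (by
      intro t _ ht
      rw [Finset.mem_range] at ht
      rw [Nat.choose_eq_zero_of_lt (by omega : (j : ℕ) < t)]
      simp)
  have e2 := Finset.sum_subset
    (f := fun t => (if t ≤ r + i then ((r + c).choose (r + i - t) : ℤ) else 0) *
      ((j : ℕ).choose t : ℤ))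
    (Finset.range_subset_range.2 (show r + i + 1 ≤ n + (r + i + 1) by omega)) (by
      intro t _ ht
      rw [Finset.mem_range] at ht
      rw [if_neg (by omega), zero_mul])
  rw [e1, ← e2]
  refine Finset.sum_congr rfl fun t ht => ?_
  have := Finset.mem_range.1 ht
  rw [if_pos (by omega), mul_comm]

/-- MacMahon's product formula, with the denominators cleared. -/
theorem det_binomialMatrix_mul (r c n : ℕ) :
    (binomialMatrix r c n).det * ∏ i ∈ Finset.range n,
        (((r + i).factorial : ℤ) * (c + i).factorial) =
      ∏ i ∈ Finset.range n, (((r + c + i).factorial : ℤ) * i.factorial) := by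
  have h1 := congrArg Matrix.det (binomialMatrix_mul_unitriangular r c n)
  rw [Matrix.det_mul, det_choose_unitriangular, mul_one] at h1
  have h2 : (Matrix.of fun i j : Fin n => ((c + j).factorial : ℤ) *
      (Matrix.of fun i j : Fin n => ((r + i).factorial : ℤ) *
        (Matrix.of fun i j : Fin n => ((r + c + j).choose (r + i) : ℤ)) i j) i j) =
      Matrix.of fun i j : Fin n => ((r + c + j).factorial : ℤ) *
        (Matrix.of fun i j : Fin n => ((c + i).descFactorial j : ℤ)).transpose i j := by
    ext i j
    have := choose_factorial_identity r c i j
    simp only [Matrix.of_apply, Matrix.transpose_apply]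
    zify at this
    linear_combination this
  have h3 := congrArg Matrix.det h2
  rw [Matrix.det_mul_row (fun j : Fin n => ((c + j).factorial : ℤ)),
    Matrix.det_mul_column (fun i : Fin n => ((r + i).factorial : ℤ)),
    Matrix.det_mul_row (fun j : Fin n => ((r + c + j).factorial : ℤ)), ← h1,
    Matrix.det_transpose, det_descFactorial_add,
    Fin.prod_univ_eq_prod_range (fun i => ((c + i).factorial : ℤ)),
    Fin.prod_univ_eq_prod_range (fun i => ((r + i).factorial : ℤ)),
    Fin.prod_univ_eq_prod_range (fun i => ((r + c + i).factorial : ℤ))] at h3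
  rw [Finset.prod_mul_distrib, Finset.prod_mul_distrib]
  linear_combination h3

/-! ### Divisibility of the determinant by a prime -/

/-- The sum `⌊0 / q⌋ + ⌊1 / q⌋ + ⋯ + ⌊(x - 1) / q⌋`; summed over the powers `q` of a prime `p`, it
is the `p`-adic valuation of `0! 1! ⋯ (x - 1)!`. -/
def floorSum (q x : ℕ) : ℕ := ∑ t ∈ Finset.range x, t / q

theorem floorSum_add_sum (q x n : ℕ) :
    floorSum q (x + n) = floorSum q x + ∑ t ∈ Finset.range n, (x + t) / q :=
  Finset.sum_range_add _ _ _

theorem floorSum_of_le {q x : ℕ} (h : x ≤ q) : floorSum q x = 0 :=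
  Finset.sum_eq_zero fun _ ht =>
    Nat.div_eq_of_lt (lt_of_lt_of_le (Finset.mem_range.1 ht) h)

theorem floorSum_add_self {q : ℕ} (hq : 0 < q) (x : ℕ) :
    floorSum q (x + q) = floorSum q x + x := by
  induction x with
  | zero =>
    rw [zero_add, floorSum_of_le le_rfl]
    rfl
  | succ x ih =>
    rw [show x + 1 + q = x + q + 1 by ring, floorSum, Finset.sum_range_succ, ← floorSum, ih,
      Nat.add_div_right x hq, floorSum, floorSum, Finset.sum_range_succ]
    ring

/-- The contribution of the modulus `q` to the number of plane partitions in an `r × c × n` box: by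
Legendre's formula, summation over the powers `q` of a prime `p` gives the `p`-adic valuation of
that number. -/
def boxDefect (q r c n : ℕ) : ℤ :=
  floorSum q (r + c + n) + floorSum q r + floorSum q c + floorSum q n
    - floorSum q (r + c) - floorSum q (r + n) - floorSum q (c + n)

theorem boxDefect_rotate (q r c n : ℕ) : boxDefect q r c n = boxDefect q c n r := by
  simp only [boxDefect, show c + n + r = r + c + n by ring, add_comm c r, add_comm n r]
  ring

/-- Each of the four terms of `boxDefect` that contain `r` grows by its argument when `r` is
replaced by `r + q`, and these arguments cancel. -/
theorem boxDefect_add_mul {q : ℕ} (hq : 0 < q) (r c n u : ℕ) :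
    boxDefect q (r + q * u) c n = boxDefect q r c n := by
  induction u with
  | zero => simp
  | succ u ih =>
    rw [← ih]
    have h1 := floorSum_add_self hq (r + q * u)
    have h2 := floorSum_add_self hq (r + q * u + c)
    have h3 := floorSum_add_self hq (r + q * u + n)
    have h4 := floorSum_add_self hq (r + q * u + c + n)
    simp only [boxDefect, show r + q * (u + 1) = r + q * u + q by ring,
      show r + q * u + c + q + n = r + q * u + c + n + q by ring,
      show r + q * u + q + c = r + q * u + c + q by ring,
      show r + q * u + q + n = r + q * u + n + q by ring, h1, h2, h3, h4]
    push_cast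
    ring

theorem boxDefect_mod_left {q : ℕ} (hq : 0 < q) (r c n : ℕ) :
    boxDefect q (r % q) c n = boxDefect q r c n := by
  conv_rhs => rw [← Nat.mod_add_div r q]
  rw [boxDefect_add_mul hq]

theorem boxDefect_mod {q : ℕ} (hq : 0 < q) (r c n : ℕ) :
    boxDefect q (r % q) (c % q) (n % q) = boxDefect q r c n := by
  rw [boxDefect_mod_left hq, boxDefect_rotate, boxDefect_mod_left hq, boxDefect_rotate,
    boxDefect_mod_left hq, boxDefect_rotate]

/-- The condition on the residues of `r`, `c`, `n` modulo `q` under which the number of plane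
partitions in an `r × c × n` box has no factor coming from `q`. -/
def BoxGood (q r c n : ℕ) : Prop :=
  r % q = 0 ∨ c % q = 0 ∨ n % q = 0 ∨ r % q + c % q + n % q ≤ q ∨
    2 * q ≤ r % q + c % q + n % q

theorem boxDefect_nonneg_and_eq_zero_iff {q : ℕ} (hq : 0 < q) (r c n : ℕ) :
    0 ≤ boxDefect q r c n ∧ (boxDefect q r c n = 0 ↔ BoxGood q r c n) := by
  rw [← boxDefect_mod hq, BoxGood]
  have hr := Nat.mod_lt r hq
  have hc := Nat.mod_lt c hq
  have hn := Nat.mod_lt n hq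
  generalize r % q = r at *
  generalize c % q = c at *
  generalize n % q = n at *
  -- below `3 q` the function `floorSum q` is piecewise linear
  have T (x : ℕ) : (x ≤ q → floorSum q x = 0) ∧ (q ≤ x → x ≤ 2 * q → floorSum q x + q = x) ∧
      (2 * q ≤ x → x ≤ 3 * q → floorSum q x + 3 * q = 2 * x) := by
    refine ⟨floorSum_of_le, fun h1 h2 => ?_, fun h1 h2 => ?_⟩
    · obtain ⟨y, rfl⟩ := Nat.exists_eq_add_of_le' h1
      rw [floorSum_add_self hq, floorSum_of_le (by omega)]
      omega
    · obtain ⟨y, rfl⟩ := Nat.exists_eq_add_of_le' h1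
      rw [two_mul, ← add_assoc, floorSum_add_self hq, floorSum_add_self hq,
        floorSum_of_le (by omega)]
      omega
  have h1 := T (r + c + n)
  have h2 := (T r).1 hr.le
  have h3 := (T c).1 hc.le
  have h4 := (T n).1 hn.le
  have h5 := T (r + c)
  have h6 := T (r + n)
  have h7 := T (c + n)
  rw [boxDefect, h2, h3, h4]
  generalize floorSum q (r + c + n) = x1 at *
  generalize floorSum q (r + c) = x2 at *
  generalize floorSum q (r + n) = x3 at *
  generalize floorSum q (c + n) = x4 at *
  omega

theorem padicValNat_prod_factorial {p : ℕ} [Fact p.Prime] {x n B : ℕ} (hB : x + n ≤ B) :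
    padicValNat p (∏ i ∈ Finset.range n, (x + i).factorial) =
      ∑ s ∈ Finset.Ico 1 (B + 1), ∑ i ∈ Finset.range n, (x + i) / p ^ s := by
  rw [Finset.sum_comm]
  induction n with
  | zero => simp
  | succ n ih =>
    rw [Finset.prod_range_succ, Finset.sum_range_succ,
      padicValNat.mul (Finset.prod_ne_zero_iff.2 fun i _ => Nat.factorial_ne_zero _)
        (Nat.factorial_ne_zero _), ih (by omega), padicValNat_factorial]
    exact lt_of_le_of_lt (Nat.log_le_self p _) (by omega)

/-- The valuation of the determinant is the sum of the nonnegative terms `boxDefect (p ^ s) r c n`,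
of which those with `p ^ s > r + c + n` vanish. -/
theorem not_dvd_det_binomialMatrix_iff {p : ℕ} (hp : p.Prime) (r c n : ℕ) :
    ¬ (p : ℤ) ∣ (binomialMatrix r c n).det ↔ ∀ s, 1 ≤ s → BoxGood (p ^ s) r c n := by
  have := Fact.mk hp
  have hdet := congrArg Int.natAbs (det_binomialMatrix_mul r c n)
  rw [Int.natCast_dvd]
  rw [Int.natAbs_mul, Finset.prod_mul_distrib, Finset.prod_mul_distrib] at hdet
  generalize (binomialMatrix r c n).det.natAbs = d at *
  norm_cast at hdet
  have hprod (x : ℕ) : ∏ i ∈ Finset.range n, (x + i).factorial ≠ 0 :=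
    Finset.prod_ne_zero_iff.2 fun i _ => Nat.factorial_ne_zero _
  have hprod0 : ∏ i ∈ Finset.range n, i.factorial ≠ 0 :=
    Finset.prod_ne_zero_iff.2 fun i _ => Nat.factorial_ne_zero _
  have hd : d ≠ 0 := by
    rintro rfl
    rw [zero_mul] at hdet
    exact mul_ne_zero (hprod _) hprod0 hdet.symm
  have hv := congrArg (padicValNat p) hdet
  have hv0 := padicValNat_prod_factorial (p := p) (show 0 + n ≤ r + c + n by omega)
  simp only [zero_add] at hv0
  rw [padicValNat.mul hd (mul_ne_zero (hprod _) (hprod _)), padicValNat.mul (hprod _) (hprod _),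
    padicValNat.mul (hprod _) hprod0, hv0,
    padicValNat_prod_factorial (show r + n ≤ r + c + n by omega),
    padicValNat_prod_factorial (show c + n ≤ r + c + n by omega),
    padicValNat_prod_factorial (show r + c + n ≤ r + c + n by omega)] at hv
  have hsum : (padicValNat p d : ℤ) =
      ∑ s ∈ Finset.Ico 1 (r + c + n + 1), boxDefect (p ^ s) r c n := by
    have hb (s : ℕ) : boxDefect (p ^ s) r c n =
        (∑ i ∈ Finset.range n, (r + c + i) / p ^ s : ℕ) + (∑ i ∈ Finset.range n, i / p ^ s : ℕ)
        - ((∑ i ∈ Finset.range n, (r + i) / p ^ s : ℕ) +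
          (∑ i ∈ Finset.range n, (c + i) / p ^ s : ℕ) : ℤ) := by
      have h0 := floorSum_add_sum (p ^ s) (r + c) n
      have h1 := floorSum_add_sum (p ^ s) r n
      have h2 := floorSum_add_sum (p ^ s) c n
      rw [boxDefect, h0, h1, h2, floorSum.eq_def _ n]
      push_cast
      ring
    simp only [hb, Finset.sum_sub_distrib, Finset.sum_add_distrib, ← Nat.cast_sum]
    omega
  have hpos (s : ℕ) : 0 < p ^ s := Nat.pow_pos hp.pos
  rw [dvd_iff_padicValNat_ne_zero hd, not_not, ← Nat.cast_eq_zero (R := ℤ), hsum,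
    Finset.sum_eq_zero_iff_of_nonneg
      fun s _ => (boxDefect_nonneg_and_eq_zero_iff (hpos s) r c n).1]
  simp only [(boxDefect_nonneg_and_eq_zero_iff (hpos _) r c n).2, Finset.mem_Ico]
  refine ⟨fun h s hs => ?_, fun h s hs => h s hs.1⟩
  rcases lt_or_ge s (r + c + n + 1) with hs' | hs'
  · exact h s ⟨hs, hs'⟩
  · have hlt : s < p ^ s := Nat.lt_pow_self hp.one_lt
    have h1 := Nat.mod_le r (p ^ s)
    have h2 := Nat.mod_le c (p ^ s)
    have h3 := Nat.mod_le n (p ^ s)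
    exact Or.inr (Or.inr (Or.inr (Or.inl (by omega))))

/-! ### Residue conditions -/

/-- The condition that for every `1 ≤ n ≤ min a b` the modulus `q` contributes no factor to the
number of plane partitions in an `(a - n) × (b - n) × n` box. -/
def AllBoxesGood (q a b : ℕ) : Prop :=
  ∀ n, 1 ≤ n → n ≤ a → n ≤ b → BoxGood q (a - n) (b - n) n

theorem allBoxesGood_comm (q a b : ℕ) : AllBoxesGood q a b ↔ AllBoxesGood q b a := by
  have key (a b : ℕ) (h : AllBoxesGood q a b) : AllBoxesGood q b a := by
    intro n h1 h2 h3
    have := h n h1 h3 h2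
    unfold BoxGood at *
    omega
  exact ⟨key a b, key b a⟩

theorem sub_mod_eq_of_mod_le {q a n : ℕ} (hna : n ≤ a) (hn : n ≤ a % q) :
    (a - n) % q = a % q - n := by
  rcases Nat.eq_zero_or_pos q with rfl | hq
  · simp
  have h := Nat.mod_add_div a q
  have hlt := Nat.mod_lt a hq
  rw [show a - n = (a % q - n) + q * (a / q) by omega, Nat.add_mul_mod_self_left,
    Nat.mod_eq_of_lt (by omega)]

theorem sub_mod_eq_of_lt_mod {q a n : ℕ} (hna : n ≤ a) (hn : a % q < n) (hnq : n < q) :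
    (a - n) % q = a % q + q - n := by
  have h := Nat.mod_add_div a q
  have hq : 0 < q := by omega
  have hlt := Nat.mod_lt a hq
  have h0 : a / q ≠ 0 := by
    intro h0
    rw [h0] at h
    omega
  obtain ⟨u, hu⟩ := Nat.exists_eq_succ_of_ne_zero h0
  rw [hu, Nat.mul_succ] at h
  rw [show a - n = (a % q + q - n) + q * u by omega, Nat.add_mul_mod_self_left,
    Nat.mod_eq_of_lt (by omega)]

theorem sub_mod_cases {q a n : ℕ} (hna : n ≤ a) (hn : n < q) :
    (n ≤ a % q ∧ (a - n) % q = a % q - n) ∨ (a % q < n ∧ (a - n) % q = a % q + q - n) := by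
  rcases le_or_gt n (a % q) with h | h
  · exact Or.inl ⟨h, sub_mod_eq_of_mod_le hna h⟩
  · exact Or.inr ⟨h, sub_mod_eq_of_lt_mod hna h hn⟩

/-- The condition on a box in terms of the residues of `a` and `b`: if `n` lies strictly between
them, it fails, whatever the values. -/
theorem BoxGood.residues {q a b n : ℕ} (h : BoxGood q (a - n) (b - n) n) (hn : n < q)
    (hn0 : n ≠ 0) (hna : n ≤ a) (hnb : n ≤ b) :
    n = a % q ∨ n = b % q ∨
    (n < a % q ∧ n < b % q ∧ a % q + b % q ≤ q + n) ∨
    (a % q < n ∧ b % q < n ∧ n ≤ a % q + b % q) := by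
  have h1 := sub_mod_cases hna hn
  have h2 := sub_mod_cases hnb hn
  have h3 := Nat.mod_lt a (show 0 < q by omega)
  have h4 := Nat.mod_lt b (show 0 < q by omega)
  rw [BoxGood, Nat.mod_eq_of_lt hn] at h
  generalize (a - n) % q = x at *
  generalize (b - n) % q = y at *
  omega

theorem residues_of_allBoxesGood {q a b : ℕ} (hq : 3 ≤ q) (hodd : q % 2 = 1) (hqa : q ≤ a)
    (hqb : q ≤ b) (h : AllBoxesGood q a b) (hab : a % q ≤ b % q) :
    (a % q = (q - 1) / 2 ∨ a % q = (q + 1) / 2) ∧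
      (b % q = (q - 1) / 2 ∨ b % q = (q + 1) / 2) := by
  have hB := Nat.mod_lt b (show 0 < q by omega)
  have key (n : ℕ) (h1 : n ≠ 0) (hn : n < q) :=
    (h n (by omega) (by omega) (by omega)).residues hn h1 (by omega) (by omega)
  generalize a % q = A at *
  generalize b % q = B at *
  -- the values `n = 1`, `n = A + 1` and `n = q - 1` decide
  have k1 := key 1 one_ne_zero (by omega)
  have k2 : B ≤ A + 1 := by
    by_contra hlt
    have := key (A + 1) (by omega) (by omega)
    omega
  have k3 := key (q - 1) (by omega) (by omega)
  clear key
  omega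

/-- If `n` runs through all residues modulo `q`, then `a` and `b` have to be as close as possible
to `q / 2` modulo `q`. -/
theorem allBoxesGood_iff_of_le {q a b : ℕ} (hq : 3 ≤ q) (hodd : q % 2 = 1) (hqa : q ≤ a)
    (hqb : q ≤ b) :
    AllBoxesGood q a b ↔ (a % q = (q - 1) / 2 ∨ a % q = (q + 1) / 2) ∧
      (b % q = (q - 1) / 2 ∨ b % q = (q + 1) / 2) := by
  constructor
  · intro h
    rcases le_total (a % q) (b % q) with hab | hab
    · exact residues_of_allBoxesGood hq hodd hqa hqb h hab
    · exact (residues_of_allBoxesGood hq hodd hqb hqa ((allBoxesGood_comm q a b).1 h) hab).symm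
  · rintro ⟨hA', hB'⟩ n h1 h2 h3
    have key (n : ℕ) (hn : n < q) (h1 : n ≤ a) (h2 : n ≤ b) : BoxGood q (a - n) (b - n) n := by
      have a1 := sub_mod_cases h1 hn
      have b1 := sub_mod_cases h2 hn
      rw [BoxGood, Nat.mod_eq_of_lt hn]
      omega
    have h4 := key (n % q) (Nat.mod_lt _ (by omega)) (le_trans (Nat.mod_le _ _) h2)
      (le_trans (Nat.mod_le _ _) h3)
    have e (a : ℕ) (h : n ≤ a) : (a - n % q) % q = (a - n) % q := by
      conv_rhs => rw [← Nat.add_mul_mod_self_left _ q (n / q)]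
      congr 1
      have := Nat.mod_add_div n q
      omega
    rw [BoxGood, e a h2, e b h3, Nat.mod_mod] at h4
    exact h4

theorem allBoxesGood_iff_of_lt {q a b : ℕ} (ha : 2 ≤ a) (hqa : a < q) (hab : a ≤ b) :
    AllBoxesGood q a b ↔ a ≤ b % q + 1 ∧ a + b % q ≤ q + 1 := by
  have hB := Nat.mod_lt b (show 0 < q by omega)
  constructor
  · intro h
    have k1 := h 1 le_rfl (by omega) (by omega)
    have b1 := sub_mod_cases (q := q) (a := b) (n := 1) (by omega) (by omega)
    have k2 := h (a - 1) (by omega) (by omega) (by omega)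
    have b2 := sub_mod_cases (q := q) (a := b) (n := a - 1) (by omega) (by omega)
    rw [BoxGood, Nat.mod_eq_of_lt (show a - 1 < q by omega),
      Nat.mod_eq_of_lt (show 1 < q by omega)] at k1
    rw [BoxGood, Nat.mod_eq_of_lt (show a - 1 < q by omega),
      Nat.mod_eq_of_lt (show a - (a - 1) < q by omega)] at k2
    generalize b % q = B at *
    generalize (b - 1) % q = B1 at *
    generalize (b - (a - 1)) % q = B2 at *
    omega
  · rintro ⟨h, h'⟩ n h1 h2 h3
    have b1 := sub_mod_cases (q := q) (a := b) (n := n) (by omega) (by omega)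
    rw [BoxGood, Nat.mod_eq_of_lt (show n < q by omega),
      Nat.mod_eq_of_lt (show a - n < q by omega)]
    omega

theorem allBoxesGood_iff_of_lt_of_lt {q a b : ℕ} (ha : 2 ≤ a) (hb : 2 ≤ b) (hqa : a < q)
    (hqb : b < q) : AllBoxesGood q a b ↔ a + b ≤ q + 1 := by
  rcases le_total a b with h | h
  · rw [allBoxesGood_iff_of_lt ha hqa h, Nat.mod_eq_of_lt hqb]
    omega
  · rw [allBoxesGood_comm, allBoxesGood_iff_of_lt hb hqb h, Nat.mod_eq_of_lt hqa]
    omega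

/-- The conditions for a modulus above `a` propagate to the multiples of that modulus. -/
theorem residue_condition_of_dvd {q q' a b : ℕ} (hq' : 0 < q') (hdvd : q ∣ q')
    (h : a ≤ b % q + 1 ∧ a + b % q ≤ q + 1) : a ≤ b % q' + 1 ∧ a + b % q' ≤ q' + 1 := by
  have hq : 0 < q := Nat.pos_of_dvd_of_pos hdvd hq'
  have h1 := Nat.mod_mod_of_dvd b hdvd
  have h2 := Nat.mod_le (b % q') q
  have h3 : b % q' + q ≤ q' + b % q := by
    obtain ⟨w, rfl⟩ := hdvd
    have h4 := Nat.mod_add_div (b % (q * w)) q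
    have h5 : b % (q * w) / q < w := Nat.div_lt_of_lt_mul (Nat.mod_lt _ hq')
    have h6 : q * (b % (q * w) / q + 1) ≤ q * w := Nat.mul_le_mul_left q h5
    rw [Nat.mul_add] at h6
    omega
  omega

/-! ### Base `p` digits -/

theorem sum_digits_lt {p j : ℕ} {c : ℕ → ℕ} (h : ∀ i < j, c i < p) :
    ∑ i ∈ Finset.range j, c i * p ^ i < p ^ j := by
  induction j with
  | zero => simp
  | succ j ih =>
    have h1 := ih fun i hi => h i (by omega)
    have h2 : (c j + 1) * p ^ j ≤ p * p ^ j := Nat.mul_le_mul_right _ (h j (by omega))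
    rw [Finset.sum_range_succ, pow_succ, mul_comm (p ^ j) p]
    rw [add_mul, one_mul] at h2
    omega

namespace IsBaseExpansion

variable {p n k : ℕ} {c : ℕ → ℕ}

theorem mod_pow_eq (h : IsBaseExpansion p n k c) {j : ℕ} (hj : j ≤ k + 1) :
    n % p ^ j = ∑ i ∈ Finset.range j, c i * p ^ i := by
  obtain ⟨t, ht⟩ := Nat.exists_eq_add_of_le hj
  have hdvd : p ^ j ∣ ∑ i ∈ Finset.range t, c (j + i) * p ^ (j + i) :=
    Finset.dvd_sum fun i _ => Dvd.dvd.mul_left (pow_dvd_pow p (Nat.le_add_right j i)) _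
  obtain ⟨y, hy⟩ := hdvd
  rw [h.eq_sum, ht, Finset.sum_range_add, hy, Nat.add_mul_mod_self_left,
    Nat.mod_eq_of_lt (sum_digits_lt fun i hi => h.digit_lt i (by omega))]

theorem mod_pow_succ (h : IsBaseExpansion p n k c) {j : ℕ} (hj : j ≤ k) :
    n % p ^ (j + 1) = n % p ^ j + c j * p ^ j := by
  rw [h.mod_pow_eq (by omega), h.mod_pow_eq (by omega), Finset.sum_range_succ]

theorem mod_eq (h : IsBaseExpansion p n k c) : n % p = c 0 := by
  simpa [Nat.mod_one] using h.mod_pow_succ (Nat.zero_le k)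

theorem lt_pow (h : IsBaseExpansion p n k c) : n < p ^ (k + 1) := by
  rw [h.eq_sum]
  exact sum_digits_lt fun i hi => h.digit_lt i (by omega)

theorem pow_le (h : IsBaseExpansion p n k c) : p ^ k ≤ n := by
  rw [h.eq_sum, Finset.sum_range_succ]
  have := Nat.mul_le_mul_right (p ^ k) (Nat.one_le_iff_ne_zero.2 h.leading_ne_zero)
  omega

end IsBaseExpansion

/-- If `r` is a half of the odd number `P`, up to rounding, then `r + c P` is a half of `p P`, up to
rounding, only for the middle digit `c`. -/
theorem half_succ_iff {p P r c : ℕ} (hp : p % 2 = 1) (hP : P % 2 = 1) (hP3 : 3 ≤ P)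
    (hr : r = (P - 1) / 2 ∨ r = (P + 1) / 2) :
    (r + c * P = (P * p - 1) / 2 ∨ r + c * P = (P * p + 1) / 2) ↔ c = (p - 1) / 2 := by
  obtain ⟨h, rfl⟩ : ∃ h, p = 2 * h + 1 := ⟨p / 2, by omega⟩
  obtain ⟨g, rfl⟩ : ∃ g, P = 2 * g + 1 := ⟨P / 2, by omega⟩
  have e : (2 * g + 1) * (2 * h + 1) = 2 * (h * (2 * g + 1) + g) + 1 := by ring
  rw [e, show (2 * h + 1 - 1) / 2 = h by omega]
  rcases lt_trichotomy c h with hc | rfl | hc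
  · have : (c + 1) * (2 * g + 1) ≤ h * (2 * g + 1) := Nat.mul_le_mul_right _ hc
    rw [add_mul, one_mul] at this
    generalize c * (2 * g + 1) = x at *
    generalize h * (2 * g + 1) = y at *
    omega
  · generalize c * (2 * g + 1) = x at *
    omega
  · have : (h + 1) * (2 * g + 1) ≤ c * (2 * g + 1) := Nat.mul_le_mul_right _ hc
    rw [add_mul, one_mul] at this
    generalize c * (2 * g + 1) = x at *
    generalize h * (2 * g + 1) = y at *
    omega

theorem IsBaseExpansion.half_residues_iff {p n k j : ℕ} {c : ℕ → ℕ} (h : IsBaseExpansion p n k c)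
    (hp : p % 2 = 1) (hp2 : 2 < p) (hj : 1 ≤ j)
    (hjk : j ≤ k) :
    (∀ s, 1 ≤ s → s ≤ j → n % p ^ s = (p ^ s - 1) / 2 ∨ n % p ^ s = (p ^ s + 1) / 2) ↔
      (c 0 = (p - 1) / 2 ∨ c 0 = (p + 1) / 2) ∧ ∀ i, 1 ≤ i → i < j → c i = (p - 1) / 2 := by
  have step (i : ℕ) (hi : 1 ≤ i) (hij : i < j)
      (hr : n % p ^ i = (p ^ i - 1) / 2 ∨ n % p ^ i = (p ^ i + 1) / 2) :
      (n % p ^ (i + 1) = (p ^ (i + 1) - 1) / 2 ∨ n % p ^ (i + 1) = (p ^ (i + 1) + 1) / 2) ↔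
        c i = (p - 1) / 2 := by
    have hodd : p ^ i % 2 = 1 := Nat.odd_iff.1 (Odd.pow (Nat.odd_iff.2 hp))
    have h3 : p ≤ p ^ i := Nat.le_self_pow (by omega) p
    rw [h.mod_pow_succ (by omega), pow_succ, half_succ_iff hp hodd (by omega) hr]
  constructor
  · intro H
    refine ⟨by simpa [h.mod_eq] using H 1 le_rfl hj, fun i hi hij => ?_⟩
    exact (step i hi hij (H i hi hij.le)).1 (H (i + 1) (by omega) hij)
  · rintro ⟨h0, h1⟩ s hs
    induction s, hs using Nat.le_induction with
    | base =>
      intro _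
      simpa [h.mod_eq] using h0
    | succ s hs ih =>
      intro hsj
      exact (step s hs hsj (ih (by omega))).2 (h1 s hs hsj)

theorem leading_digit_conditions {p P α β a' b' : ℕ} (hP3 : 3 ≤ P) (hP : P % 2 = 1) (hp : 0 < p)
    (ha : a' = (P - 1) / 2 ∨ a' = (P + 1) / 2) (hb : b' = (P - 1) / 2 ∨ b' = (P + 1) / 2) :
    ((a' + α * P) + (b' + β * P) ≤ P * p + 1 ↔ α + β ≤ p - 1) ∧
      (a' + α * P ≤ b' + β * P + 1 ↔ α ≤ β) := by
  constructor
  · rcases le_or_gt (α + β + 1) p with h | h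
    · have h1 : (α + β + 1) * P ≤ p * P := Nat.mul_le_mul_right _ h
      rw [add_mul, add_mul, one_mul, mul_comm p P] at h1
      omega
    · have h1 : (p + 1) * P ≤ (α + β + 1) * P := Nat.mul_le_mul_right _ h
      rw [add_mul, add_mul, add_mul, one_mul, mul_comm p P] at h1
      omega
  · rcases le_or_gt α β with h | h
    · have h1 : α * P ≤ β * P := Nat.mul_le_mul_right _ h
      omega
    · have h1 : (β + 1) * P ≤ α * P := Nat.mul_le_mul_right _ h
      rw [add_mul, one_mul] at h1
      omega

theorem allBoxesGood_iff_of_lt_prime {p a b : ℕ} (ha : 2 ≤ a) (hb : 2 ≤ b)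
    (hap : a < p) (hbp : b < p) :
    (∀ s, 1 ≤ s → AllBoxesGood (p ^ s) a b) ↔ a + b ≤ p + 1 := by
  constructor
  · intro h
    have := h 1 le_rfl
    rwa [pow_one, allBoxesGood_iff_of_lt_of_lt ha hb hap hbp] at this
  · intro h s hs
    have h1 : p ≤ p ^ s := Nat.le_self_pow (by omega) p
    rw [allBoxesGood_iff_of_lt_of_lt ha hb (by omega) (by omega)]
    omega

theorem allBoxesGood_iff_of_lt_prime_le {p a b : ℕ} (ha : 2 ≤ a) (hap : a < p) (hpb : p ≤ b) :
    (∀ s, 1 ≤ s → AllBoxesGood (p ^ s) a b) ↔ a ≤ min (b % p) (p - b % p) + 1 := by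
  have hB := Nat.mod_lt b (show 0 < p by omega)
  trans a ≤ b % p + 1 ∧ a + b % p ≤ p + 1
  · constructor
    · intro h
      have := h 1 le_rfl
      rwa [pow_one, allBoxesGood_iff_of_lt ha hap (by omega)] at this
    · intro h s hs
      have h1 : p ≤ p ^ s := Nat.le_self_pow (by omega) p
      rw [allBoxesGood_iff_of_lt ha (by omega) (by omega)]
      exact residue_condition_of_dvd (by omega) (dvd_pow_self p (by omega)) h
  · omega

theorem allBoxesGood_iff_digits {p a b k l : ℕ} {α β : ℕ → ℕ} (hp : p % 2 = 1) (hp2 : 2 < p)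
    (hα : IsBaseExpansion p a k α) (hβ : IsBaseExpansion p b l β) (hkl : k ≤ l) (hk : 1 ≤ k) :
    (∀ s, 1 ≤ s → AllBoxesGood (p ^ s) a b) ↔
        ((α 0 = (p - 1) / 2 ∨ α 0 = (p + 1) / 2) ∧ (β 0 = (p - 1) / 2 ∨ β 0 = (p + 1) / 2)) ∧
        (∀ i, 1 ≤ i → i < k → α i = (p - 1) / 2 ∧ β i = (p - 1) / 2) ∧
        (α k + β k ≤ p - 1 ∧ (k < l → α k ≤ β k)) := by
  have hodd (s : ℕ) : p ^ s % 2 = 1 := Nat.odd_iff.1 (Odd.pow (Nat.odd_iff.2 hp))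
  have h3 (s : ℕ) (hs : 1 ≤ s) : 3 ≤ p ^ s := by
    have : p ≤ p ^ s := Nat.le_self_pow (by omega) p
    omega
  have hka := hα.pow_le
  have hkb : p ^ k ≤ b := (Nat.pow_le_pow_right (by omega) hkl).trans hβ.pow_le
  have hak := hα.lt_pow
  have ha2 : 2 ≤ a := by have := h3 k hk; omega
  have hb2 : 2 ≤ b := by have := h3 k hk; omega
  have low (s : ℕ) (hs : 1 ≤ s) (hsk : s ≤ k) := by
    have h1 : p ^ s ≤ p ^ k := Nat.pow_le_pow_right (by omega) hsk
    exact allBoxesGood_iff_of_le (h3 s hs) (hodd s) (h1.trans hka) (h1.trans hkb)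
  have hA := hα.half_residues_iff hp hp2 hk le_rfl
  have hB := hβ.half_residues_iff hp hp2 hk hkl
  -- the moduli up to `p ^ k` determine the digits below position `k`
  have hlow : (∀ s, 1 ≤ s → s ≤ k → AllBoxesGood (p ^ s) a b) ↔
      ((α 0 = (p - 1) / 2 ∨ α 0 = (p + 1) / 2) ∧ (β 0 = (p - 1) / 2 ∨ β 0 = (p + 1) / 2)) ∧
        ∀ i, 1 ≤ i → i < k → α i = (p - 1) / 2 ∧ β i = (p - 1) / 2 := by
    constructor
    · intro h
      have hA' := hA.1 fun s hs hsk => ((low s hs hsk).1 (h s hs hsk)).1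
      have hB' := hB.1 fun s hs hsk => ((low s hs hsk).1 (h s hs hsk)).2
      exact ⟨⟨hA'.1, hB'.1⟩, fun i hi hik => ⟨hA'.2 i hi hik, hB'.2 i hi hik⟩⟩
    · rintro ⟨⟨h1, h2⟩, h4⟩ s hs hsk
      exact (low s hs hsk).2 ⟨hA.2 ⟨h1, fun i hi hik => (h4 i hi hik).1⟩ s hs hsk,
        hB.2 ⟨h2, fun i hi hik => (h4 i hi hik).2⟩ s hs hsk⟩
  -- the larger moduli concern the digits in position `k`
  have hhigh (hres : ∀ s, 1 ≤ s → s ≤ k → AllBoxesGood (p ^ s) a b) :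
      (∀ s, k + 1 ≤ s → AllBoxesGood (p ^ s) a b) ↔
        (α k + β k ≤ p - 1 ∧ (k < l → α k ≤ β k)) := by
    obtain ⟨ra, rb⟩ := (low k hk le_rfl).1 (hres k hk le_rfl)
    have hlead := leading_digit_conditions (α := α k) (β := β k) (h3 k hk) (hodd k)
      (show 0 < p by omega) ra rb
    rw [← hα.mod_pow_succ le_rfl, ← hβ.mod_pow_succ hkl, ← pow_succ, Nat.mod_eq_of_lt hak]
      at hlead
    rw [← hlead.1, ← hlead.2]
    rcases hkl.lt_or_eq with hlt | rfl
    · have hkb' : p ^ (k + 1) ≤ b := (Nat.pow_le_pow_right (by omega) hlt).trans hβ.pow_le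
      constructor
      · intro h
        have := h (k + 1) le_rfl
        rw [allBoxesGood_iff_of_lt ha2 hak (by omega)] at this
        exact ⟨this.2, fun _ => this.1⟩
      · intro h s hs
        have h5 : p ^ (k + 1) ≤ p ^ s := Nat.pow_le_pow_right (by omega) hs
        rw [allBoxesGood_iff_of_lt ha2 (by omega) (by omega)]
        exact residue_condition_of_dvd (by omega) (pow_dvd_pow p hs) ⟨h.2 hlt, h.1⟩
    · have hbk := hβ.lt_pow
      rw [Nat.mod_eq_of_lt hbk]
      constructor
      · intro h
        have := h (k + 1) le_rfl
        rw [allBoxesGood_iff_of_lt_of_lt ha2 hb2 hak hbk] at this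
        exact ⟨this, fun h => absurd h (lt_irrefl _)⟩
      · intro h s hs
        have h5 : p ^ (k + 1) ≤ p ^ s := Nat.pow_le_pow_right (by omega) hs
        rw [allBoxesGood_iff_of_lt_of_lt ha2 hb2 (by omega) (by omega)]
        omega
  rw [← and_assoc, ← hlow]
  constructor
  · intro h
    have hres : ∀ s, 1 ≤ s → s ≤ k → AllBoxesGood (p ^ s) a b := fun s hs _ => h s hs
    exact ⟨hres, (hhigh hres).1 fun s hs => h s (by omega)⟩
  · rintro ⟨hres, h⟩ s hs
    rcases le_or_gt s k with hsk | hsk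
    · exact hres s hs hsk
    · exact (hhigh hres).2 h s hsk

/-! ### Coordinates on the algebra -/

/-- The exponent of the monomial `x ^ j * y ^ l`. -/
noncomputable def expo (j l : ℕ) : Fin 2 →₀ ℕ :=
  Finsupp.single 0 j + Finsupp.single 1 l

@[simp] theorem expo_zero (j l : ℕ) : expo j l 0 = j := by simp [expo]

@[simp] theorem expo_one (j l : ℕ) : expo j l 1 = l := by simp [expo]

theorem eq_expo (d : Fin 2 →₀ ℕ) : d = expo (d 0) (d 1) := by
  ext i
  fin_cases i <;> simp

theorem expo_le_iff {j l : ℕ} {d : Fin 2 →₀ ℕ} : expo j l ≤ d ↔ j ≤ d 0 ∧ l ≤ d 1 := by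
  rw [Finsupp.le_def, Fin.forall_fin_two, expo_zero, expo_one]

theorem expo_inj {j l j' l' : ℕ} : expo j l = expo j' l' ↔ j = j' ∧ l = l' := by
  refine ⟨fun h => ?_, by rintro ⟨rfl, rfl⟩; rfl⟩
  exact ⟨by simpa using DFunLike.congr_fun h 0, by simpa using DFunLike.congr_fun h 1⟩

theorem expo_sub (j l j' l' : ℕ) : expo j l - expo j' l' = expo (j - j') (l - l') := by
  ext i
  fin_cases i <;> simp

theorem degree_expo (j l : ℕ) : (expo j l).degree = j + l := by
  simp [expo, map_add]

section Coordinates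

variable {K : Type*} [Field K] {a b : ℕ}

open MvPolynomial

theorem mem_ciIdeal_iff {f : MvPolynomial (Fin 2) K} :
    f ∈ ciIdeal K a b ↔ ∀ j l, j < a → l < b → coeff (expo j l) f = 0 := by
  have h : ciIdeal K a b =
      Ideal.span ((fun s => monomial s (1 : K)) '' {expo a 0, expo 0 b}) := by
    rw [ciIdeal, Set.image_pair, X_pow_eq_monomial, X_pow_eq_monomial]
    simp [expo]
  rw [h, mem_ideal_span_monomial_image]
  constructor
  · intro H j l hj hl
    by_contra hne
    obtain ⟨d, hd, hle⟩ := H _ (mem_support_iff.2 hne)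
    rcases hd with rfl | rfl
    · rw [expo_le_iff] at hle
      simp at hle
      omega
    · rw [expo_le_iff] at hle
      simp at hle
      omega
  · intro H d hd
    rw [mem_support_iff, eq_expo d] at hd
    rcases lt_or_ge (d 0) a with h0 | h0
    · rcases lt_or_ge (d 1) b with h1 | h1
      · exact absurd (H _ _ h0 h1) hd
      · exact ⟨expo 0 b, by simp, expo_le_iff.2 ⟨Nat.zero_le _, h1⟩⟩
    · exact ⟨expo a 0, by simp, expo_le_iff.2 ⟨h0, Nat.zero_le _⟩⟩

/-- The coefficient of `x ^ j * y ^ l`, for `j < a` and `l < b`, as a linear form on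
`K[x, y] / (x ^ a, y ^ b)`. -/
noncomputable def ciCoeff {j l : ℕ} (hj : j < a) (hl : l < b) : CIAlgebra K a b →ₗ[K] K :=
  ((ciIdeal K a b).restrictScalars K).liftQ (lcoeff K (expo j l))
      (fun _ hf => mem_ciIdeal_iff.1 hf j l hj hl) ∘ₗ
    (Submodule.Quotient.restrictScalarsEquiv K (ciIdeal K a b)).symm.toLinearMap

theorem ciCoeff_mk {j l : ℕ} (hj : j < a) (hl : l < b) (f : MvPolynomial (Fin 2) K) :
    ciCoeff hj hl (Ideal.Quotient.mk (ciIdeal K a b) f) = coeff (expo j l) f :=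
  rfl

/-- The coefficients of the monomials `x ^ (r + i) * y ^ (c + n - 1 - i)`, for `i < n`, as
functions on a graded piece of `K[x, y] / (x ^ a, y ^ b)`. -/
noncomputable def ciCoord {r c n : ℕ} (hr : r + n ≤ a) (hc : c + n ≤ b) (e : ℕ) :
    ciGrading K a b e →ₗ[K] (Fin n → K) :=
  LinearMap.pi fun i : Fin n =>
    ciCoeff (j := r + i) (l := c + (n - 1 - i)) (by omega) (by omega) ∘ₗ
      (ciGrading K a b e).subtype

theorem exists_rep {e : ℕ} (x : ciGrading K a b e) :
    ∃ f : MvPolynomial (Fin 2) K, f.IsHomogeneous e ∧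
      Ideal.Quotient.mk (ciIdeal K a b) f = (x : CIAlgebra K a b) := by
  obtain ⟨f, hf, h⟩ := x.2
  exact ⟨f, (mem_homogeneousSubmodule e f).1 hf, h⟩

theorem mk_mem_ciGrading {e : ℕ} {f : MvPolynomial (Fin 2) K} (hf : f.IsHomogeneous e) :
    Ideal.Quotient.mk (ciIdeal K a b) f ∈ ciGrading K a b e :=
  mk_mem_quotientGrading _ ((mem_homogeneousSubmodule e f).2 hf)

theorem ciCoord_mk {r c n : ℕ} (hr : r + n ≤ a) (hc : c + n ≤ b) {e : ℕ}
    {x : ciGrading K a b e} {f : MvPolynomial (Fin 2) K}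
    (h : Ideal.Quotient.mk (ciIdeal K a b) f = (x : CIAlgebra K a b)) (i : Fin n) :
    ciCoord hr hc e x i = coeff (expo (r + i) (c + (n - 1 - i))) f := by
  rw [← ciCoeff_mk (a := a) (b := b) (by omega) (by omega), h]
  rfl

/-- If the monomials of degree `e` that survive in the quotient are exactly those counted by
`ciCoord`, then `ciCoord` gives coordinates on the degree `e` part. -/
theorem ciCoord_bijective {r c n e : ℕ} (hr : r + n ≤ a) (hc : c + n ≤ b)
    (he : e + 1 = r + c + n)
    (hall : ∀ j l, j + l = e → j < a → l < b → r ≤ j ∧ c ≤ l) :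
    Function.Bijective (ciCoord (K := K) hr hc e) := by
  constructor
  · rw [injective_iff_map_eq_zero]
    intro x hx
    obtain ⟨f, hf, hfx⟩ := exists_rep x
    apply Subtype.ext
    rw [← hfx, Submodule.coe_zero, Ideal.Quotient.eq_zero_iff_mem, mem_ciIdeal_iff]
    intro j l hj hl
    by_cases hjl : j + l = e
    · obtain ⟨h1, h2⟩ := hall j l hjl hj hl
      have := congrFun hx ⟨j - r, by omega⟩
      rw [ciCoord_mk hr hc hfx] at this
      rw [← show r + (j - r) = j by omega, ← show c + (n - 1 - (j - r)) = l by omega]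
      exact this
    · exact hf.coeff_eq_zero (by rwa [degree_expo])
  · intro v
    have hf : (∑ i : Fin n, monomial (expo (r + i) (c + (n - 1 - i))) (v i)).IsHomogeneous e :=
      IsHomogeneous.sum _ _ _ fun i _ =>
        isHomogeneous_monomial _ (by rw [degree_expo]; omega)
    refine ⟨⟨_, mk_mem_ciGrading hf⟩, funext fun i => ?_⟩
    rw [ciCoord_mk hr hc rfl, coeff_sum, Finset.sum_eq_single i]
    · simp
    · intro j _ hji
      rw [coeff_monomial, if_neg]
      rw [expo_inj]
      intro h
      exact hji (Fin.ext (by omega))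
    · simp

/-! ### The matrix of multiplication by a power of a linear form -/

theorem eq_sum_monomial_of_isHomogeneous {f : MvPolynomial (Fin 2) K} {e n : ℕ}
    (hf : f.IsHomogeneous e) (hn : e + 1 = n) :
    f = ∑ j : Fin n, monomial (expo j (n - 1 - j)) (coeff (expo j (n - 1 - j)) f) := by
  ext d
  rw [coeff_sum, eq_expo d]
  by_cases hd : d 0 + d 1 = e
  · rw [Finset.sum_eq_single ⟨d 0, by omega⟩]
    · rw [show n - 1 - d 0 = d 1 by omega, coeff_monomial, if_pos rfl]
    · intro j _ hj
      rw [coeff_monomial, if_neg]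
      rw [expo_inj]
      intro h
      exact hj (Fin.ext h.1)
    · simp
  · rw [hf.coeff_eq_zero (by rwa [degree_expo]), Finset.sum_eq_zero]
    intro j _
    rw [coeff_monomial, if_neg]
    rw [expo_inj]
    omega

theorem coeff_linearForm_pow (s t : K) (m u v : ℕ) :
    coeff (expo u v) ((monomial (expo 1 0) s + monomial (expo 0 1) t) ^ m) =
      if u + v = m then (m.choose u : K) * s ^ u * t ^ v else 0 := by
  have h (k l : ℕ) : monomial (expo 1 0) s ^ k * monomial (expo 0 1) t ^ l =
      monomial (expo k l) (s ^ k * t ^ l) := by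
    have he : k • expo 1 0 + l • expo 0 1 = expo k l := by
      ext i
      fin_cases i <;> simp
    rw [monomial_pow, monomial_pow, monomial_mul, he]
  simp only [add_pow, h, coeff_sum, ← C_eq_coe_nat, mul_comm _ (C _), coeff_C_mul, coeff_monomial,
    expo_inj]
  split_ifs with huv
  · rw [Finset.sum_eq_single u]
    · rw [if_pos ⟨rfl, by omega⟩, show m - u = v by omega, mul_assoc]
    · intro k _ hk
      rw [if_neg (fun h => hk h.1), mul_zero]
    · intro hu
      rw [Finset.mem_range] at hu
      omega
  · refine Finset.sum_eq_zero fun k hk => ?_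
    rw [Finset.mem_range] at hk
    rw [if_neg (by omega), mul_zero]

/-- The matrix of the multiplication by `(s x + t y) ^ (r + c)`, from the degree `n - 1` part of
`K[x, y] / (x ^ (r + n), y ^ (c + n))` to its degree `r + c + n - 1` part, in the monomial bases. -/
def lefschetzMatrix (s t : K) (r c n : ℕ) : Matrix (Fin n) (Fin n) K :=
  Matrix.of fun i j => if (j : ℕ) ≤ r + i ∧ (i : ℕ) ≤ c + j then
    ((r + c).choose (r + i - j) : K) * s ^ (r + i - j) * t ^ (c + j - i) else 0

theorem coeff_linearForm_pow_mul (s t : K) (r c : ℕ) {e n : ℕ} {f : MvPolynomial (Fin 2) K}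
    (hf : f.IsHomogeneous e) (hn : e + 1 = n) (i : Fin n) :
    coeff (expo (r + i) (c + (n - 1 - i)))
        ((monomial (expo 1 0) s + monomial (expo 0 1) t) ^ (r + c) * f) =
      (lefschetzMatrix s t r c n).mulVec (fun j => coeff (expo j (n - 1 - j)) f) i := by
  conv_lhs => rw [eq_sum_monomial_of_isHomogeneous hf hn]
  rw [Finset.mul_sum, coeff_sum, Matrix.mulVec, dotProduct]
  refine Finset.sum_congr rfl fun j _ => ?_
  rw [coeff_mul_monomial', lefschetzMatrix, Matrix.of_apply]
  have hi := i.2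
  have hj := j.2
  have hiff : expo j (n - 1 - j) ≤ expo (r + i) (c + (n - 1 - i)) ↔
      (j : ℕ) ≤ r + i ∧ (i : ℕ) ≤ c + j := by
    rw [expo_le_iff, expo_zero, expo_one]
    omega
  by_cases h : (j : ℕ) ≤ r + i ∧ (i : ℕ) ≤ c + j
  · rw [if_pos (hiff.2 h), if_pos h, expo_sub, coeff_linearForm_pow, if_pos (by omega),
      show c + (n - 1 - (i : ℕ)) - (n - 1 - j) = c + j - i by omega]
  · rw [if_neg (mt hiff.1 h), if_neg h, zero_mul]

theorem det_lefschetzMatrix_ne_zero_iff {s t : K} (hs : s ≠ 0) (ht : t ≠ 0) (r c n : ℕ) :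
    (lefschetzMatrix s t r c n).det ≠ 0 ↔ ((binomialMatrix r c n).det : K) ≠ 0 := by
  have h : lefschetzMatrix s t r c n = Matrix.of fun i j : Fin n =>
      (s ^ (r + i) * t ^ (c + (n - 1 - i))) * (Matrix.of fun i j : Fin n =>
        (s ^ (j : ℕ) * t ^ (n - 1 - j))⁻¹ *
          (binomialMatrix r c n).map (Int.castRingHom K) i j) i j := by
    ext i j
    simp only [lefschetzMatrix, binomialMatrix, Matrix.of_apply, Matrix.map_apply]
    have hi := i.2
    have hj := j.2
    by_cases h1 : (j : ℕ) ≤ r + i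
    · by_cases h2 : (i : ℕ) ≤ c + j
      · rw [if_pos ⟨h1, h2⟩, if_pos h1]
        have e1 : s ^ (r + (i : ℕ)) = s ^ (r + i - j) * s ^ (j : ℕ) := by
          rw [← pow_add]; congr 1; omega
        have e2 : t ^ (c + (n - 1 - (i : ℕ))) = t ^ (c + j - i) * t ^ (n - 1 - (j : ℕ)) := by
          rw [← pow_add]; congr 1; omega
        rw [e1, e2]
        field_simp
        simp
      · rw [if_neg (fun h => h2 h.2), if_pos h1, Nat.choose_eq_zero_of_lt (by omega)]
        simp
    · rw [if_neg (fun h => h1 h.1), if_neg h1]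
      simp
  rw [h, Matrix.det_mul_column (fun i : Fin n => s ^ (r + i) * t ^ (c + (n - 1 - i))),
    Matrix.det_mul_row (fun j : Fin n => (s ^ (j : ℕ) * t ^ (n - 1 - j))⁻¹),
    ← RingHom.mapMatrix_apply, ← RingHom.map_det, mul_ne_zero_iff, mul_ne_zero_iff,
    Finset.prod_ne_zero_iff, Finset.prod_ne_zero_iff]
  simp [hs, ht]

theorem exists_linearForm (x : ciGrading K a b 1) : ∃ s t : K,
    Ideal.Quotient.mk (ciIdeal K a b) (monomial (expo 1 0) s + monomial (expo 0 1) t) =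
      (x : CIAlgebra K a b) := by
  obtain ⟨f, hf, hfx⟩ := exists_rep x
  refine ⟨coeff (expo 1 0) f, coeff (expo 0 1) f, ?_⟩
  rw [← hfx]
  congr 1
  conv_rhs => rw [eq_sum_monomial_of_isHomogeneous hf rfl]
  simp [Fin.sum_univ_two, add_comm]

theorem hasMaximalRank_iff_det_ne_zero {x : ciGrading K a b 1} {s t : K}
    (hx : Ideal.Quotient.mk (ciIdeal K a b) (monomial (expo 1 0) s + monomial (expo 0 1) t) =
      (x : CIAlgebra K a b)) {e n m : ℕ} (hn : e + 1 = n) (hna : n ≤ a) (hnb : n ≤ b)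
    (hm : m = (a - n) + (b - n)) :
    HasMaximalRank (gradedMul (ciGrading K a b) (linearFormPow (ciGrading K a b) x m) e) ↔
      (lefschetzMatrix s t (a - n) (b - n) n).det ≠ 0 := by
  have hr0 : 0 + n ≤ a := by omega
  have hc0 : 0 + n ≤ b := by omega
  have hr1 : (a - n) + n ≤ a := by omega
  have hc1 : (b - n) + n ≤ b := by omega
  have hb0 := ciCoord_bijective (K := K) hr0 hc0 (e := e) (by omega)
    (fun j l _ _ _ => ⟨Nat.zero_le _, Nat.zero_le _⟩)
  have hb1 := ciCoord_bijective (K := K) hr1 hc1 (e := e + m) (by omega) (by intros; omega)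
  set φ := gradedMul (ciGrading K a b) (linearFormPow (ciGrading K a b) x m) e with hφ
  set M := lefschetzMatrix s t (a - n) (b - n) n
  have hcomm : ciCoord hr1 hc1 (e + m) ∘ φ = M.mulVec ∘ ciCoord hr0 hc0 e := by
    funext y
    obtain ⟨f, hf, hfy⟩ := exists_rep y
    have hmul : Ideal.Quotient.mk (ciIdeal K a b)
        ((monomial (expo 1 0) s + monomial (expo 0 1) t) ^ m * f) = (φ y : CIAlgebra K a b) := by
      rw [map_mul, map_pow, hx, hfy]
      rfl
    have hy : ciCoord hr0 hc0 e y = fun j : Fin n => coeff (expo j (n - 1 - j)) f := by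
      funext j
      rw [ciCoord_mk hr0 hc0 hfy, zero_add, zero_add]
    funext i
    rw [Function.comp_apply, Function.comp_apply, ciCoord_mk hr1 hc1 hmul, hm,
      coeff_linearForm_pow_mul s t _ _ hf hn, hy]
  have hinj : Function.Injective φ ↔ Function.Injective M.mulVec := by
    rw [← hb1.1.of_comp_iff φ, hcomm, Function.Injective.of_comp_iff' _ hb0]
  have hsurj : Function.Surjective φ ↔ Function.Surjective M.mulVec := by
    rw [← Function.Surjective.of_comp_iff' hb1 φ, hcomm, hb0.2.of_comp_iff]
  rw [HasMaximalRank, hinj, hsurj, Matrix.mulVec_injective_iff_isUnit,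
    Matrix.mulVec_surjective_iff_isUnit, or_self, Matrix.isUnit_iff_isUnit_det, isUnit_iff_ne_zero]

end Coordinates

/-! ### Reduction to the multiplications between complementary degrees -/

section Powers

variable {K A : Type*} [Field K] [CommRing A] [Algebra K A] {𝒜 : ℕ → Submodule K A}
  [GradedAlgebra 𝒜] {x : 𝒜 1}

theorem coe_gradedMul_linearFormPow (m i : ℕ) (y : 𝒜 i) :
    (gradedMul 𝒜 (linearFormPow 𝒜 x m) i y : A) = (x : A) ^ m * y :=
  rfl

theorem injective_pow_iff {m i : ℕ} :
    Function.Injective (gradedMul 𝒜 (linearFormPow 𝒜 x m) i) ↔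
      ∀ y ∈ 𝒜 i, (x : A) ^ m * y = 0 → y = 0 := by
  rw [injective_iff_map_eq_zero]
  constructor
  · intro h y hy h0
    exact congrArg Subtype.val (h ⟨y, hy⟩ (Subtype.ext h0))
  · intro h y h0
    exact Subtype.ext (h y y.2 (congrArg Subtype.val h0))

theorem surjective_pow_iff {m i : ℕ} :
    Function.Surjective (gradedMul 𝒜 (linearFormPow 𝒜 x m) i) ↔
      ∀ z ∈ 𝒜 (i + m), ∃ y ∈ 𝒜 i, (x : A) ^ m * y = z := by
  constructor
  · intro h z hz
    obtain ⟨y, hy⟩ := h ⟨z, hz⟩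
    exact ⟨y, y.2, congrArg Subtype.val hy⟩
  · intro h z
    obtain ⟨y, hy, hyz⟩ := h z z.2
    exact ⟨⟨y, hy⟩, Subtype.ext hyz⟩

theorem injective_pow_of_add {m m' i : ℕ}
    (h : Function.Injective (gradedMul 𝒜 (linearFormPow 𝒜 x (m + m')) i)) :
    Function.Injective (gradedMul 𝒜 (linearFormPow 𝒜 x m) i) := by
  rw [injective_pow_iff] at *
  intro y hy h0
  exact h y hy (by rw [add_comm, pow_add, mul_assoc, h0, mul_zero])

theorem surjective_pow_of_add {m m' i : ℕ}
    (h : Function.Surjective (gradedMul 𝒜 (linearFormPow 𝒜 x (m + m')) i)) :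
    Function.Surjective (gradedMul 𝒜 (linearFormPow 𝒜 x m') (i + m)) := by
  rw [surjective_pow_iff] at *
  intro z hz
  obtain ⟨y, hy, rfl⟩ := h z (by rwa [← add_assoc])
  exact ⟨_, (gradedMul 𝒜 (linearFormPow 𝒜 x m) i ⟨y, hy⟩).2, by
    rw [coe_gradedMul_linearFormPow, ← mul_assoc, ← pow_add, add_comm]⟩

theorem injective_pow_of_surjective_of_add {m m' i : ℕ}
    (h : Function.Surjective (gradedMul 𝒜 (linearFormPow 𝒜 x m) i))
    (h' : Function.Injective (gradedMul 𝒜 (linearFormPow 𝒜 x (m + m')) i)) :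
    Function.Injective (gradedMul 𝒜 (linearFormPow 𝒜 x m') (i + m)) := by
  rw [injective_pow_iff] at *
  rw [surjective_pow_iff] at h
  intro z hz h0
  obtain ⟨y, hy, rfl⟩ := h z hz
  rw [h' y hy (by rw [add_comm, pow_add, mul_assoc, h0]), mul_zero]

theorem injective_pow_zero (i : ℕ) :
    Function.Injective (gradedMul 𝒜 (linearFormPow 𝒜 x 0) i) := by
  rw [injective_pow_iff]
  intro y _ h
  simpa using h

end Powers

section Reduction

variable {K : Type*} [Field K] {a b : ℕ}

theorem finrank_ciGrading {r c n e : ℕ} (hr : r + n ≤ a) (hc : c + n ≤ b)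
    (he : e + 1 = r + c + n)
    (hall : ∀ j l, j + l = e → j < a → l < b → r ≤ j ∧ c ≤ l) :
    Module.Finite K (ciGrading K a b e) ∧ Module.finrank K (ciGrading K a b e) = n := by
  have E := LinearEquiv.ofBijective _ (ciCoord_bijective (K := K) hr hc he hall)
  exact ⟨Module.Finite.equiv E.symm, by rw [E.finrank_eq, Module.finrank_fin_fun]⟩

theorem finrank_ciGrading_low {e : ℕ} (ha : e + 1 ≤ a) (hb : e + 1 ≤ b) :
    Module.Finite K (ciGrading K a b e) ∧ Module.finrank K (ciGrading K a b e) = e + 1 :=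
  finrank_ciGrading (r := 0) (c := 0) (by omega) (by omega) (by omega) (by intros; omega)

theorem finrank_ciGrading_middle {e : ℕ} (h1 : min a b ≤ e + 1) (h2 : e + 1 ≤ max a b) :
    Module.Finite K (ciGrading K a b e) ∧ Module.finrank K (ciGrading K a b e) = min a b := by
  rcases le_total a b with h | h
  · exact finrank_ciGrading (r := 0) (c := e + 1 - a) (by omega) (by omega) (by omega)
      (by intros; omega)
  · exact finrank_ciGrading (r := e + 1 - b) (c := 0) (by omega) (by omega) (by omega)
      (by intros; omega)

theorem finrank_ciGrading_high {n e : ℕ} (ha : n ≤ a) (hb : n ≤ b) (he : e + 1 + n = a + b) :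
    Module.Finite K (ciGrading K a b e) ∧ Module.finrank K (ciGrading K a b e) = n :=
  finrank_ciGrading (r := a - n) (c := b - n) (by omega) (by omega) (by omega)
    (by intros; omega)

theorem ciGrading_eq_bot {e : ℕ} (he : a + b ≤ e + 1) (y : CIAlgebra K a b)
    (hy : y ∈ ciGrading K a b e) : y = 0 := by
  obtain ⟨f, hf, hfy⟩ := exists_rep ⟨y, hy⟩
  rw [← show _ = y from hfy, Ideal.Quotient.eq_zero_iff_mem, mem_ciIdeal_iff]
  intro j l hj hl
  exact hf.coeff_eq_zero (by rw [degree_expo]; omega)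

/-- A linear form is a strong Lefschetz element as soon as its powers have maximal rank between
complementary degrees: each of these maps is then bijective, and so is each map from the degree
`min a b - 1` to a degree up to `max a b - 1`. Every other multiplication by a power is, unless its
target vanishes, a factor of one of these maps. -/
theorem isStrongLefschetzElement_iff (x : ciGrading K a b 1) (ha : 1 ≤ a) (hb : 1 ≤ b) :
    IsStrongLefschetzElement (ciGrading K a b) x ↔ ∀ n, 1 ≤ n → n ≤ a → n ≤ b →
      HasMaximalRank (gradedMul (ciGrading K a b)
        (linearFormPow (ciGrading K a b) x ((a - n) + (b - n))) (n - 1)) := by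
  constructor
  · intro h n h1 h2 h3
    rcases Nat.eq_zero_or_pos ((a - n) + (b - n)) with h0 | h0
    · rw [h0]
      exact Or.inl (injective_pow_zero _)
    · exact h _ _ h0
  · intro h i m hm
    -- the maps between complementary degrees `e` and `a + b - 2 - e` are bijective
    have bij (e m : ℕ) (hea : e + 1 ≤ a) (heb : e + 1 ≤ b) (hem : m + 2 * e + 2 = a + b) :
        Function.Injective (gradedMul (ciGrading K a b)
          (linearFormPow (ciGrading K a b) x m) e) ∧
        Function.Surjective (gradedMul (ciGrading K a b)
          (linearFormPow (ciGrading K a b) x m) e) := by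
      have h1 := h (e + 1) (by omega) hea heb
      rw [show (a - (e + 1)) + (b - (e + 1)) = m by omega, Nat.add_sub_cancel] at h1
      obtain ⟨i1, d1⟩ := finrank_ciGrading_low (K := K) hea heb
      obtain ⟨i2, d2⟩ := finrank_ciGrading_high (K := K) hea heb (e := e + m) (by omega)
      have h2 := LinearMap.injective_iff_surjective_of_finrank_eq_finrank (d1.trans d2.symm)
        (f := gradedMul (ciGrading K a b) (linearFormPow (ciGrading K a b) x m) e)
      rw [HasMaximalRank, h2, or_self] at h1
      exact ⟨h2.2 h1, h1⟩
    by_cases c1 : i + 1 ≤ a ∧ i + 1 ≤ b ∧ m + 2 * i + 2 ≤ a + b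
    · have := (bij i (m + (a + b - 2 - 2 * i - m)) c1.1 c1.2.1 (by omega)).1
      exact Or.inl (injective_pow_of_add this)
    by_cases c2 : max a b ≤ i + m
    · right
      by_cases c3 : a + b ≤ i + m + 1
      · rw [surjective_pow_iff]
        intro z hz
        exact ⟨0, zero_mem _, by rw [ciGrading_eq_bot c3 z hz, mul_zero]⟩
      · obtain ⟨e, he⟩ : ∃ e, e + (i + m) + 2 = a + b := ⟨a + b - 2 - (i + m), by omega⟩
        obtain ⟨d, rfl⟩ : ∃ d, i = e + d := ⟨i - e, by omega⟩
        exact surjective_pow_of_add (bij e (d + m) (by omega) (by omega) (by omega)).2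
    · obtain ⟨d, rfl⟩ : ∃ d, i = (min a b - 1) + d := ⟨i - (min a b - 1), by omega⟩
      have hinj := (bij (min a b - 1) ((d + m) + (max a b - min a b - (d + m)))
        (by omega) (by omega) (by omega)).1
      have hinj1 := injective_pow_of_add hinj
      have hinj2 := injective_pow_of_add hinj1
      obtain ⟨i1, d1⟩ := finrank_ciGrading_middle (K := K) (a := a) (b := b)
        (e := min a b - 1) (by omega) (by omega)
      obtain ⟨i2, d2⟩ := finrank_ciGrading_middle (K := K) (a := a) (b := b)
        (e := min a b - 1 + d) (by omega) (by omega)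
      have hsurj := (LinearMap.injective_iff_surjective_of_finrank_eq_finrank
        (d1.trans d2.symm)).1 hinj2
      exact Or.inl (injective_pow_of_surjective_of_add hsurj hinj1)

/-- The strong Lefschetz property amounts to the non-vanishing in `K` of the numbers of plane
partitions in the boxes of sides `a - n`, `b - n`, `n`. A linear form lacking one of the variables
is not a strong Lefschetz element: its power of degree `a + b - 2` vanishes. -/
theorem hasStrongLefschetzProperty_iff (ha : 2 ≤ a) (hb : 2 ≤ b) :
    HasStrongLefschetzProperty (ciGrading K a b) ↔ ∀ n, 1 ≤ n → n ≤ a → n ≤ b →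
      ((binomialMatrix (a - n) (b - n) n).det : K) ≠ 0 := by
  have key (x : ciGrading K a b 1) {s t : K}
      (hx : Ideal.Quotient.mk (ciIdeal K a b)
        (MvPolynomial.monomial (expo 1 0) s + MvPolynomial.monomial (expo 0 1) t) =
        (x : CIAlgebra K a b)) :
      IsStrongLefschetzElement (ciGrading K a b) x ↔ ∀ n, 1 ≤ n → n ≤ a → n ≤ b →
        (lefschetzMatrix s t (a - n) (b - n) n).det ≠ 0 := by
    rw [isStrongLefschetzElement_iff x (by omega) (by omega)]
    refine forall_congr' fun n => forall_congr' fun h1 => forall_congr' fun h2 =>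
      forall_congr' fun h3 => ?_
    exact hasMaximalRank_iff_det_ne_zero hx (by omega) h2 h3 rfl
  constructor
  · rintro ⟨x, hx⟩
    obtain ⟨s, t, hst⟩ := exists_linearForm x
    rw [key x hst] at hx
    have h1 := hx 1 le_rfl (by omega) (by omega)
    rw [Matrix.det_fin_one, lefschetzMatrix, Matrix.of_apply, if_pos (by simp)] at h1
    have hs : s ≠ 0 := by
      rintro rfl
      simp [show a - 1 ≠ 0 by omega] at h1
    have ht : t ≠ 0 := by
      rintro rfl
      simp [show b - 1 ≠ 0 by omega] at h1
    intro n hn1 hna hnb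
    exact (det_lefschetzMatrix_ne_zero_iff hs ht _ _ _).1 (hx n hn1 hna hnb)
  · intro h
    have hmem := mk_mem_ciGrading (K := K) (a := a) (b := b) (e := 1)
      (f := MvPolynomial.monomial (expo 1 0) 1 + MvPolynomial.monomial (expo 0 1) 1)
      (MvPolynomial.IsHomogeneous.add
        (MvPolynomial.isHomogeneous_monomial _ (degree_expo 1 0))
        (MvPolynomial.isHomogeneous_monomial _ (degree_expo 0 1)))
    refine ⟨⟨_, hmem⟩, (key ⟨_, hmem⟩ rfl).2 fun n h1 h2 h3 => ?_⟩
    exact (det_lefschetzMatrix_ne_zero_iff one_ne_zero one_ne_zero _ _ _).2 (h n h1 h2 h3)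

theorem hasStrongLefschetzProperty_iff_allBoxesGood (p : ℕ) [CharP K p] (hp : p.Prime)
    (ha : 2 ≤ a) (hb : 2 ≤ b) :
    HasStrongLefschetzProperty (ciGrading K a b) ↔ ∀ s, 1 ≤ s → AllBoxesGood (p ^ s) a b := by
  rw [hasStrongLefschetzProperty_iff ha hb]
  have h (n : ℕ) : ((binomialMatrix (a - n) (b - n) n).det : K) ≠ 0 ↔
      ∀ s, 1 ≤ s → BoxGood (p ^ s) (a - n) (b - n) n := by
    rw [Ne, CharP.intCast_eq_zero_iff K p, not_dvd_det_binomialMatrix_iff hp]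
  simp only [h]
  exact ⟨fun H s hs n h1 h2 h3 => H n h1 h2 h3 s hs, fun H n h1 h2 h3 s hs => H s hs n h1 h2 h3⟩

end Reduction

/-! ### The digit criterion -/

theorem mainTheorem1 {K : Type*} [Field K] (p : ℕ) [CharP K p] (hp : 2 < p)
    (a b : ℕ) (ha : 2 ≤ a) (hb : 2 ≤ b)
    (k l : ℕ) (α β : ℕ → ℕ) (hα : IsBaseExpansion p a k α) (hβ : IsBaseExpansion p b l β)
    (hkl : k ≤ l) :
    (a < p → b < p →
      (HasStrongLefschetzProperty (ciGrading K a b) ↔ a + b ≤ p + 1)) ∧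
    (a < p → p ≤ b →
      (HasStrongLefschetzProperty (ciGrading K a b) ↔ a ≤ min (β 0) (p - β 0) + 1)) ∧
    (p ≤ a → p ≤ b →
      (HasStrongLefschetzProperty (ciGrading K a b) ↔
        ((α 0 = (p - 1) / 2 ∨ α 0 = (p + 1) / 2) ∧ (β 0 = (p - 1) / 2 ∨ β 0 = (p + 1) / 2)) ∧
        (∀ i, 1 ≤ i → i < k → α i = (p - 1) / 2 ∧ β i = (p - 1) / 2) ∧
        (α k + β k ≤ p - 1 ∧ (k < l → α k ≤ β k)))) := by
  have hprime : p.Prime := (CharP.char_is_prime_or_zero K p).resolve_right (by omega)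
  rw [hasStrongLefschetzProperty_iff_allBoxesGood p hprime ha hb]
  refine ⟨fun hap hbp => allBoxesGood_iff_of_lt_prime ha hb hap hbp, fun hap hpb => ?_,
    fun hpa _ => ?_⟩
  · rw [allBoxesGood_iff_of_lt_prime_le ha hap hpb, hβ.mod_eq]
  · have hk : 1 ≤ k := by
      by_contra h
      have h1 := hα.lt_pow
      rw [show k = 0 by omega, zero_add, pow_one] at h1
      omega
    exact allBoxesGood_iff_digits (hprime.eq_two_or_odd.resolve_left (by omega)) hp hα hβ hkl hk
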